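/- Let $H$ be a group, let $A,B\leqslant H$ be subgroups, let $\varphi\colon A\to B$ be an isomorphism, and let $G=H\ast_t=\langle H,t\mid tat^{-1}=\varphi(a),\ a\in A\rangle$ be the corresponding HNN-extension, with $H$ regarded as a subgroup of $G$. Let $N\lhd H$ with $N\cap(A\cup B)=\{1\}$, let $\langle\!\langle N\rangle\!\rangle$ be the normal closure of $N$ in $G$, and put $Q=G/\langle\!\langle N\rangle\!\rangle$ and $R=H/N$. Then: 1. The triple $(G,H,N)$ has the Cohen–Lyndon property: there is a left transversal $T$ of $H\langle\!\langle N\rangle\!\rangle$ in $G$ such that $\langle\!\langle N\rangle\!\rangle$ is the free product of its subgroups $tNt^{-1}$, $t\in T$. 2. The natural map $R\to Q$ is injective, and there is an isomorphism of $\mathbb{Z}Q$-modules $$Rel(G,\langle\!\langle N\rangle\!\rangle)\cong Ind_R^Q\,Rel(H,N)=\mathbb{Z}Q\otimes_{\mathbb{Z}R}Rel(H,N).$$ Here, for a normal subgroup $M$ of a group $K$, $Rel(K,M)$ denotes the abelianization $M/[M,M]$ regarded as a $\mathbb{Z}[K/M]$-module via the action of $K/M$ induced by conjugation of $K$ on $M$.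 -/

import Mathlib

/-- The subgroup `M` of `G` is the (internal) free product of the indexed family of subgroups
`K i`: the canonical homomorphism from the free product of the `K i` to `G` is injective with
image `M`. -/
def IsInternalFreeProduct {G : Type*} [Group G] {ι : Type*} (M : Subgroup G)
    (K : ι → Subgroup G) : Prop :=
  Function.Injective (Monoid.CoprodI.lift fun i => (K i).subtype) ∧
    (Monoid.CoprodI.lift fun i => (K i).subtype).range = M

/-- The Cohen-Lyndon property of a triple `(G, H, N)`, where `N ≤ H ≤ G` and `N` is normal in `H`:
there is a left transversal `T` of the subgroup `H⟪N⟫` in `G` (every element of `G` is uniquely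
of the form `t * x` with `t ∈ T` and `x ∈ H⟪N⟫`) such that `⟪N⟫` is the free product of the
subgroups `t N t⁻¹`, `t ∈ T`. As `⟪N⟫` is normal in `G`, the join `H ⊔ ⟪N⟫` is the set of
products `H⟪N⟫`. -/
def CohenLyndonProperty {G : Type*} [Group G] (H N : Subgroup G) : Prop :=
  ∃ T : Set G,
    Subgroup.IsComplement T
      ((H ⊔ Subgroup.normalClosure (N : Set G) : Subgroup G) : Set G) ∧
    IsInternalFreeProduct (Subgroup.normalClosure (N : Set G))
      (fun t : T => N.map (MulAut.conj (t : G)).toMonoidHom)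

/-- The conjugation action of `G` on the abelianization of a normal subgroup `N`,
`g ∘ n̄ = (g n g⁻¹)‾`, as a representation over `ℤ`. -/
def conjAbelianizationRep {G : Type*} [Group G] (N : Subgroup G) [N.Normal] :
    Representation ℤ G (Additive (Abelianization N)) where
  toFun g := (MonoidHom.toAdditive
    (Abelianization.map (MulAut.conjNormal g : MulAut N).toMonoidHom)).toIntLinearMap
  map_one' := by
    ext x
    induction x using Additive.rec with | _ x =>
    induction x using QuotientGroup.induction_on with | _ n =>
    change Additive.ofMul (Abelianization.of ((MulAut.conjNormal (1 : G) : MulAut N) n)) = _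
    rw [map_one]
    rfl
  map_mul' g h := by
    ext x
    induction x using Additive.rec with | _ x =>
    induction x using QuotientGroup.induction_on with | _ n =>
    change Additive.ofMul (Abelianization.of ((MulAut.conjNormal (g * h) : MulAut N) n)) = _
    rw [map_mul]
    rfl

theorem conjAbelianizationRep_of {G : Type*} [Group G] (N : Subgroup G) [N.Normal] (g : G)
    (n : N) : conjAbelianizationRep N g (Additive.ofMul (Abelianization.of n)) =
      Additive.ofMul (Abelianization.of (MulAut.conjNormal g n)) := rfl

theorem conjAbelianizationRep_eq_one {G : Type*} [Group G] (N : Subgroup G) [N.Normal] {g : G}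
    (hg : g ∈ N) : conjAbelianizationRep N g = 1 := by
  ext x
  induction x using Additive.rec with | _ x =>
  induction x using QuotientGroup.induction_on with | _ n =>
  change Additive.ofMul (Abelianization.of (MulAut.conjNormal g n)) =
    Additive.ofMul (Abelianization.of n)
  have h : MulAut.conjNormal g n = (⟨g, hg⟩ : N) * n * (⟨g, hg⟩ : N)⁻¹ := by
    ext
    simp
  refine congrArg Additive.ofMul ?_
  rw [h, map_mul, map_mul, map_inv, mul_right_comm, mul_inv_cancel, one_mul]

/-- The relative relation module `Rel(G, N)` of `1 → N → G → G/N → 1`: the abelianization of `N`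
with the action of `G/N` induced by conjugation. The corresponding module over the group ring
`ℤ[G/N]` is `(relRelationRep N).asModule`. -/
def relRelationRep {G : Type*} [Group G] (N : Subgroup G) [N.Normal] :
    Representation ℤ (G ⧸ N) (Additive (Abelianization N)) :=
  QuotientGroup.lift N (conjAbelianizationRep N) fun _ hg => conjAbelianizationRep_eq_one N hg

theorem relRelationRep_mk {G : Type*} [Group G] (N : Subgroup G) [N.Normal] (g : G) (n : N) :
    relRelationRep N (g : G ⧸ N) (Additive.ofMul (Abelianization.of n)) =
      Additive.ofMul (Abelianization.of (MulAut.conjNormal g n)) := rfl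

/-- For a homomorphism `f : H → G` and a normal subgroup `N` of `H`, the natural homomorphism
`H/N → G/⟪f(N)⟫` induced by `f`. -/
def quotientNormalClosureMap {H G : Type*} [Group H] [Group G] (f : H →* G) (N : Subgroup H)
    [N.Normal] : H ⧸ N →* G ⧸ Subgroup.normalClosure ((N.map f : Subgroup G) : Set G) :=
  QuotientGroup.map N (Subgroup.normalClosure ((N.map f : Subgroup G) : Set G)) f
    fun _ hn => Subgroup.subset_normalClosure (Subgroup.mem_map_of_mem f hn)

/-! Since `N` meets `A` and `B` trivially, `φ` descends to the images of `A` and `B` in `R = H/N`,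
and `π` maps `G` onto the HNN extension of `R`. The kernel of `π` meets conjugates of `H` in
conjugates of `N` and conjugates of `A` trivially, and the Bass-Serre tree of `G` modulo `ker π` is
that of the quotient, again a tree. By Bass-Serre theory `ker π` is then the free product of vertex
stabilizers, one for each vertex of the quotient tree. These are conjugates of `N` indexed by the
cosets of `H ker π`, so `ker π = ⟪N⟫`.

Bass-Serre theory is replaced here by an explicit cocycle. Let `P` be the abstract free product of
the vertex groups, `L : P → G` the natural map and `s` a section of `π` lifting the tree. The
elements `s(gq)⁻¹ g s(q)` of `ker π` are lifted to `c(g, q)` in `P` with `c(gk, q) = c(g, kq) c(k,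
q)`: the lift is prescribed on `H` and on `t`, and extends to `G` because it respects the HNN
relation (`stableCocycle_rel`). By `L_cocycle` the range of `L` is `ker π`. By `cocycle_s` the value
`c(s q, 1)` does not depend on `q`, so `c(L p, 1)` is a fixed conjugate of `p` (`cocycle_L`) and `L`
is injective. Normal forms in the quotient supply the lifted tree (`nonempty_treeLift`).

The relation module follows from the free product: its abelianization is the direct sum of the
abelianizations of the `t N t⁻¹`, which is the induced module. The inverse of the natural map is
defined factor by factor. -/

open Monoid

/-! ### Lifted trees and their vertex groups -/

/-- Data lifting the Bass-Serre tree of a quotient `Q` of an HNN extension: `s` chooses, compatibly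
with the cosets of the base group, a lift of every element of `Q`, the vertex lifts `(v q)⁻¹` are
constant along these cosets, and `e` is an equivariant choice of lifts of the edges. -/
structure TreeLift {H : Type*} [Group H] {A B : Subgroup H} {φ : A ≃* B} {Q : Type*} [Group Q]
    (π : HNNExtension H A B φ →* Q) where
  /-- the lifts of elements -/
  s : Q → HNNExtension H A B φ
  /-- the lifts of edges -/
  e : Q → HNNExtension H A B φ
  /-- the inverses of the lifts of vertices -/
  v : Q → HNNExtension H A B φ
  map_s : ∀ q, π (s q) = q
  map_e : ∀ q, π (e q) = q
  e_eq : ∀ q, ∃ h : H, e q = HNNExtension.of h * s q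
  t_mul_e : ∀ q, ∃ h : H, HNNExtension.t * e q = HNNExtension.of h * s (π HNNExtension.t * q)
  e_smul : ∀ (a : A) q, e (π (HNNExtension.of (a : H)) * q) = HNNExtension.of (a : H) * e q
  v_smul : ∀ (h : H) q, v (π (HNNExtension.of h) * q) = v q
  s_eq : ∀ q, ∃ h : H, s q = HNNExtension.of h * (v q)⁻¹

namespace TreeLift

open HNNExtension

variable {H : Type*} [Group H] {A B : Subgroup H} {φ : A ≃* B} {Q : Type*} [Group Q]
  {π : HNNExtension H A B φ →* Q} (D : TreeLift π) (N : Subgroup H)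

/-- The set of vertex lifts. -/
def T : Set (HNNExtension H A B φ) := Set.range D.v

/-- The vertex group attached to a vertex lift. -/
abbrev K (x : D.T) : Subgroup (HNNExtension H A B φ) :=
  (N.map of).map (MulAut.conj (x : HNNExtension H A B φ)).toMonoidHom

/-- The free product of the vertex groups. -/
abbrev P : Type _ := CoprodI fun x : D.T => D.K N x

/-- The vertex lift attached to an element, as a member of `T`. -/
def vT (q : Q) : D.T := ⟨D.v q, q, rfl⟩

/-- The natural map from the free product of the vertex groups. -/
abbrev L : D.P N →* HNNExtension H A B φ := CoprodI.lift fun x => (D.K N x).subtype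

open Classical in
/-- The element of the free product given by an element of the vertex group at `q`
(and `1` for other elements). -/
noncomputable def J (q : Q) (x : HNNExtension H A B φ) : D.P N :=
  if h : x ∈ D.K N (D.vT q) then CoprodI.of (i := D.vT q) ⟨x, h⟩ else 1

theorem J_smul (h : H) (q : Q) : D.J N (π (of h) * q) = D.J N q := by
  have : D.vT (π (of h) * q) = D.vT q := Subtype.ext (D.v_smul h q)
  funext x
  unfold J
  rw [this]

variable {N} in
theorem L_J {q : Q} {x : HNNExtension H A B φ} (hx : x ∈ D.K N (D.vT q)) :
    D.L N (D.J N q x) = x := by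
  rw [J, dif_pos hx, L, CoprodI.lift_of]
  rfl

variable {N} in
theorem J_mul {q : Q} {x y : HNNExtension H A B φ} (hx : x ∈ D.K N (D.vT q))
    (hy : y ∈ D.K N (D.vT q)) : D.J N q (x * y) = D.J N q x * D.J N q y := by
  rw [J, J, J, dif_pos hx, dif_pos hy, dif_pos (mul_mem hx hy), ← map_mul]
  rfl

theorem J_one (q : Q) : D.J N q 1 = 1 := by
  rw [J, dif_pos (one_mem _)]
  exact map_one _

variable {N}

theorem map_L (hker : ∀ h : H, π (of h) = 1 ↔ h ∈ N) (p : D.P N) : π (D.L N p) = 1 := by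
  induction p using CoprodI.induction_on with
  | one => simp
  | of i m =>
    obtain ⟨_, _, ⟨n, hn, rfl⟩, rfl⟩ := m
    simp [L, (hker n).2 hn]
  | mul x y hx hy => rw [map_mul, map_mul, hx, hy, one_mul]

variable [N.Normal]

/-- `s q` and `(v q)⁻¹` differ by a factor from `H`, which normalizes `N`, so both conjugate `N` to
the same vertex group. -/
theorem mem_K_iff {q : Q} {x : HNNExtension H A B φ} :
    x ∈ D.K N (D.vT q) ↔ ∃ n ∈ N, x = (D.s q)⁻¹ * of n * D.s q := by
  obtain ⟨h, hh⟩ := D.s_eq q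
  have key : ∀ n : H, (D.s q)⁻¹ * of n * D.s q = D.v q * of (h⁻¹ * n * h) * (D.v q)⁻¹ := by
    intro n; rw [hh]; simp [mul_assoc]
  constructor
  · rintro ⟨_, ⟨n, hn, rfl⟩, rfl⟩
    refine ⟨h * n * h⁻¹, Subgroup.Normal.conj_mem inferInstance _ hn _, ?_⟩
    rw [key]
    simp [vT, mul_assoc]
  · rintro ⟨n, hn, rfl⟩
    refine ⟨_, ⟨h⁻¹ * n * h, ?_, rfl⟩, ?_⟩
    · simpa using Subgroup.Normal.conj_mem ‹N.Normal› _ hn h⁻¹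
    · rw [key]; simp [vT]

theorem mem_K (hker : ∀ h : H, π (of h) = 1 ↔ h ∈ N) {q : Q} {x : HNNExtension H A B φ} (h : H)
    (hx : x = (D.s q)⁻¹ * of h * D.s q)
    (h1 : π x = 1) : x ∈ D.K N (D.vT q) := by
  refine D.mem_K_iff.2 ⟨h, (hker h).1 ?_, hx⟩
  rw [hx] at h1
  simp only [map_mul, map_inv, D.map_s] at h1
  simpa [mul_assoc, inv_mul_eq_one] using h1

theorem exists_s_smul (h : H) (q : Q) : ∃ h' : H, D.s (π (of h) * q) = of h' * D.s q := by
  obtain ⟨h₁, h₁'⟩ := D.s_eq (π (of h) * q)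
  obtain ⟨h₂, h₂'⟩ := D.s_eq q
  refine ⟨h₁ * h₂⁻¹, ?_⟩
  rw [h₁', h₂', D.v_smul]
  simp [mul_assoc]

theorem smul_mem_K (hker : ∀ h : H, π (of h) = 1 ↔ h ∈ N) (h : H) (q : Q) :
    (D.s (π (of h) * q))⁻¹ * of h * D.s q ∈ D.K N (D.vT q) := by
  obtain ⟨h', hh⟩ := D.exists_s_smul h q
  refine D.mem_K hker (h'⁻¹ * h) ?_ ?_
  · rw [hh]; simp [mul_assoc]
  · simp [D.map_s]

theorem t_mem_K (hker : ∀ h : H, π (of h) = 1 ↔ h ∈ N) (q : Q) :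
    (D.s (π t * q))⁻¹ * t * D.e q ∈ D.K N (D.vT (π t * q)) := by
  obtain ⟨h, hh⟩ := D.t_mul_e q
  refine D.mem_K hker h ?_ ?_
  · rw [mul_assoc, hh]; simp [mul_assoc]
  · simp [D.map_s, D.map_e]

theorem e_mem_K (hker : ∀ h : H, π (of h) = 1 ↔ h ∈ N) (q : Q) :
    (D.e q)⁻¹ * D.s q ∈ D.K N (D.vT q) := by
  obtain ⟨h, hh⟩ := D.e_eq q
  refine D.mem_K hker h⁻¹ ?_ ?_
  · rw [hh]; simp
  · simp [D.map_s, D.map_e]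

/-! ### The cocycle with values in the free product -/

variable (N) in
/-- The cocycle on the base group. -/
noncomputable def baseCocycle (h : H) (q : Q) : D.P N :=
  D.J N q ((D.s (π (of h) * q))⁻¹ * of h * D.s q)

variable (N) in
/-- The cocycle at the stable letter. -/
noncomputable def stableCocycle (q : Q) : D.P N :=
  D.J N (π t * q) ((D.s (π t * q))⁻¹ * t * D.e q) * D.J N q ((D.e q)⁻¹ * D.s q)

/-- Translation by `H` does not change the vertex, so all the factors lie in one vertex group, where
`J` is multiplicative and the product telescopes. -/
theorem baseCocycle_mul (hker : ∀ h : H, π (of h) = 1 ↔ h ∈ N) (h k : H) (q : Q) :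
    D.baseCocycle N (h * k) q =
      D.baseCocycle N h (π (of k) * q) * D.baseCocycle N k q := by
  have h1 := D.smul_mem_K hker h (π (of k) * q)
  have hv : D.vT (π (of k) * q) = D.vT q := Subtype.ext (D.v_smul k q)
  rw [hv] at h1
  unfold baseCocycle
  rw [D.J_smul N k, ← D.J_mul h1 (D.smul_mem_K hker k q)]
  simp [mul_assoc]

/-- On each side the base factor merges with the neighbouring stable factor at the same end of the
edge. The results agree because `e` is equivariant under `A`; this is where trivial edge stabilizers
enter. -/
theorem stableCocycle_rel (hker : ∀ h : H, π (of h) = 1 ↔ h ∈ N) (a : A) (q : Q) :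
    D.stableCocycle N (π (of (a : H)) * q) * D.baseCocycle N a q =
      D.baseCocycle N (φ a) (π t * q) * D.stableCocycle N q := by
  have hta : π t * (π (of (a : H)) * q) = π (of (φ a : H)) * (π t * q) := by
    rw [← mul_assoc, ← map_mul, t_mul_of, map_mul, mul_assoc]
  have hv : D.vT (π (of (a : H)) * q) = D.vT q := Subtype.ext (D.v_smul _ q)
  have h1 := D.e_mem_K hker (π (of (a : H)) * q)
  rw [hv] at h1
  unfold baseCocycle stableCocycle
  rw [hta, D.J_smul N a, D.J_smul N (φ a), mul_assoc, ← D.J_mul h1 (D.smul_mem_K hker _ q),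
    ← mul_assoc (D.J N (π t * q) _), ← D.J_mul (D.smul_mem_K hker _ _) (D.t_mem_K hker q), D.e_smul]
  congr 2
  · simp only [← mul_assoc, mul_inv_cancel_right]
    rw [mul_assoc _ t, t_mul_of]
    simp only [← mul_assoc]
  · simp [mul_assoc]

/-- The action of the HNN extension on `Q × P`. -/
noncomputable def act (hker : ∀ h : H, π (of h) = 1 ↔ h ∈ N) :
    HNNExtension H A B φ →* Equiv.Perm (Q × D.P N) :=
  HNNExtension.lift
    (MonoidHom.toHomPerm
      { toFun := fun h (x : Q × D.P N) => (π (of h) * x.1, D.baseCocycle N h x.1 * x.2)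
        map_one' := by
          funext x
          simp [baseCocycle, J_one, Function.End.one_def]
        map_mul' := fun h k => by
          funext x
          simp only [map_mul, D.baseCocycle_mul hker, mul_assoc]
          rfl })
    { toFun := fun x => (π t * x.1, D.stableCocycle N x.1 * x.2)
      invFun := fun x => ((π t)⁻¹ * x.1, (D.stableCocycle N ((π t)⁻¹ * x.1))⁻¹ * x.2)
      left_inv := fun x => by simp
      right_inv := fun x => by simp }
    (fun a => by
      ext x : 1
      refine Prod.ext ?_ ?_
      · change π t * (π (of (a : H)) * x.1) = π (of (φ a : H)) * (π t * x.1)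
        rw [← mul_assoc, ← map_mul, t_mul_of, map_mul, mul_assoc]
      · change D.stableCocycle N (π (of (a : H)) * x.1) * (D.baseCocycle N a x.1 * x.2) =
          D.baseCocycle N (φ a) (π t * x.1) * (D.stableCocycle N x.1 * x.2)
        rw [← mul_assoc, ← mul_assoc, D.stableCocycle_rel hker])

theorem act_of (hker : ∀ h : H, π (of h) = 1 ↔ h ∈ N) (h : H) (x : Q × D.P N) :
    D.act hker (of h) x = (π (of h) * x.1, D.baseCocycle N h x.1 * x.2) := by
  rw [act, lift_of]; rfl

theorem act_t (hker : ∀ h : H, π (of h) = 1 ↔ h ∈ N) (x : Q × D.P N) :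
    D.act hker t x = (π t * x.1, D.stableCocycle N x.1 * x.2) := by
  rw [act, lift_t]; rfl

/-- The cocycle on the HNN extension. -/
noncomputable def cocycle (hker : ∀ h : H, π (of h) = 1 ↔ h ∈ N) (g : HNNExtension H A B φ)
    (q : Q) : D.P N := (D.act hker g (q, 1)).2

theorem act_apply (hker : ∀ h : H, π (of h) = 1 ↔ h ∈ N) (g : HNNExtension H A B φ)
    (x : Q × D.P N) : D.act hker g x = (π g * x.1, D.cocycle hker g x.1 * x.2) := by
  induction g using HNNExtension.induction_on generalizing x with
  | of h => simp [cocycle, act_of]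
  | t => simp [cocycle, act_t]
  | mul g k hg hk =>
    have h1 := hg (D.act hker k x)
    have h2 := hg (D.act hker k (x.1, 1))
    rw [hk] at h1 h2
    rw [cocycle, map_mul, Equiv.Perm.mul_apply, Equiv.Perm.mul_apply, hk x, hk (x.1, 1), h1, h2]
    simp [mul_assoc]
  | inv g hg =>
    -- The action of `g⁻¹` is read off by undoing that of `g`; it is needed at `x` and at `(x.1,
    -- 1)`, since the latter defines the cocycle.
    have key : ∀ y : Q × D.P N, π g * (D.act hker g⁻¹ y).1 = y.1 ∧
        D.cocycle hker g (D.act hker g⁻¹ y).1 * (D.act hker g⁻¹ y).2 = y.2 := by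
      intro y
      have h1 := hg (D.act hker g⁻¹ y)
      rw [← Equiv.Perm.mul_apply, ← map_mul, mul_inv_cancel, map_one, Equiv.Perm.one_apply] at h1
      exact ⟨(congrArg Prod.fst h1).symm, (congrArg Prod.snd h1).symm⟩
    obtain ⟨h1, h2⟩ := key x
    obtain ⟨h3, h4⟩ := key (x.1, 1)
    rw [← eq_inv_mul_iff_mul_eq] at h1 h2 h3 h4
    refine Prod.ext ?_ ?_
    · simpa using h1
    · rw [h1] at h2
      rw [h3] at h4
      rw [cocycle, h2, h4, mul_one]

theorem cocycle_mul (hker : ∀ h : H, π (of h) = 1 ↔ h ∈ N) (g k : HNNExtension H A B φ) (q : Q) :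
    D.cocycle hker (g * k) q = D.cocycle hker g (π k * q) * D.cocycle hker k q := by
  rw [cocycle, map_mul, Equiv.Perm.mul_apply, D.act_apply hker k, D.act_apply hker g]
  simp

theorem cocycle_one (hker : ∀ h : H, π (of h) = 1 ↔ h ∈ N) (q : Q) :
    D.cocycle hker 1 q = 1 := by
  simp [cocycle]

theorem cocycle_inv (hker : ∀ h : H, π (of h) = 1 ↔ h ∈ N) (g : HNNExtension H A B φ) (q : Q) :
    D.cocycle hker g⁻¹ (π g * q) = (D.cocycle hker g q)⁻¹ := by
  rw [eq_inv_iff_mul_eq_one, ← cocycle_mul, inv_mul_cancel, cocycle_one]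

theorem cocycle_of (hker : ∀ h : H, π (of h) = 1 ↔ h ∈ N) (h : H) (q : Q) :
    D.cocycle hker (of h) q = D.baseCocycle N h q := by
  simp [cocycle, act_of]

theorem cocycle_t (hker : ∀ h : H, π (of h) = 1 ↔ h ∈ N) (q : Q) :
    D.cocycle hker t q = D.stableCocycle N q := by
  simp [cocycle, act_t]

theorem L_cocycle (hker : ∀ h : H, π (of h) = 1 ↔ h ∈ N) (g : HNNExtension H A B φ) (q : Q) :
    D.L N (D.cocycle hker g q) = (D.s (π g * q))⁻¹ * g * D.s q := by
  induction g using HNNExtension.induction_on generalizing q with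
  | of h => rw [cocycle_of, baseCocycle, D.L_J (D.smul_mem_K hker h q)]
  | t =>
    rw [cocycle_t, stableCocycle, map_mul, D.L_J (D.t_mem_K hker q), D.L_J (D.e_mem_K hker q)]
    simp [mul_assoc]
  | mul g k hg hk =>
    rw [cocycle_mul, map_mul, hg, hk]
    simp [mul_assoc]
  | inv g hg =>
    obtain ⟨q, rfl⟩ : ∃ q', q = π g * q' := ⟨(π g)⁻¹ * q, by simp⟩
    rw [cocycle_inv, map_inv, hg]
    simp [mul_assoc]

/-! ### The kernel as a free product -/

theorem cocycle_s_smul (hker : ∀ h : H, π (of h) = 1 ↔ h ∈ N) (h : H) (q : Q) :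
    D.cocycle hker (D.s (π (of h) * q)) 1 = D.cocycle hker (D.s q) 1 := by
  obtain ⟨h', hh⟩ := D.exists_s_smul h q
  have h1 : π (of h') * q = π (of h) * q := by
    have := congrArg π hh
    rwa [map_mul, D.map_s, D.map_s, eq_comm] at this
  rw [hh, cocycle_mul, cocycle_of, D.map_s, mul_one, baseCocycle, h1, hh]
  simp [mul_assoc, J_one]

/-- The lifts at the two ends of an edge both differ from the lifted edge by elements `h`, `k` of
`N`. In the cocycle of `k⁻¹ t h` their contributions cancel the two factors of `stableCocycle`. -/
theorem cocycle_s_t (hker : ∀ h : H, π (of h) = 1 ↔ h ∈ N) (q : Q) :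
    D.cocycle hker (D.s (π t * q)) 1 = D.cocycle hker (D.s q) 1 := by
  obtain ⟨h, hh⟩ := D.e_eq q
  obtain ⟨k, hk⟩ := D.t_mul_e q
  have h1 : π (of h) = 1 := by
    have := congrArg π hh
    rwa [map_mul, D.map_s, D.map_e, eq_comm, mul_eq_right] at this
  have h2 : π (of k) = 1 := by
    have := congrArg π hk
    rwa [map_mul, map_mul, D.map_s, D.map_e, eq_comm, mul_eq_right] at this
  have hs : D.s (π t * q) = of k⁻¹ * (t * (of h * D.s q)) := by
    rw [← hh, hk]; simp
  have h3 : D.baseCocycle N k (π t * q) =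
      D.J N (π t * q) ((D.s (π t * q))⁻¹ * t * D.e q) := by
    rw [baseCocycle, h2, one_mul, mul_assoc, mul_assoc, hk]
  have h4 : D.baseCocycle N h q * D.J N q ((D.e q)⁻¹ * D.s q) = 1 := by
    have m1 := D.smul_mem_K hker h q
    rw [baseCocycle, ← D.J_mul m1 (D.e_mem_K hker q), h1, one_mul, mul_assoc _ (of h), ← hh]
    simp [J_one]
  have h5 : D.J N q ((D.e q)⁻¹ * D.s q) * D.baseCocycle N h q = 1 := by
    rw [mul_eq_one_iff_eq_inv] at h4 ⊢
    rw [h4, inv_inv]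
  have h6 : D.cocycle hker (of k⁻¹) (π t * q) = (D.baseCocycle N k (π t * q))⁻¹ := by
    have := D.cocycle_inv hker (of k) (π t * q)
    rwa [h2, one_mul, cocycle_of, ← map_inv] at this
  rw [hs, cocycle_mul, cocycle_mul, cocycle_mul, cocycle_of _ _ h, cocycle_t, map_mul,
    map_mul, D.map_s, h1, one_mul, mul_one, mul_one, h6, h3, stableCocycle, mul_assoc (D.J N (π t * q) _),
    ← mul_assoc (D.J N q _), h5]
  simp

/-- Invariance under `H` and under `t` suffices, as these generate `G` and `π` is onto: the quotient
tree is connected. -/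
theorem cocycle_s (hker : ∀ h : H, π (of h) = 1 ↔ h ∈ N) (q : Q) :
    D.cocycle hker (D.s q) 1 = D.cocycle hker (D.s 1) 1 := by
  suffices ∀ (g : HNNExtension H A B φ) (q : Q),
      D.cocycle hker (D.s (π g * q)) 1 = D.cocycle hker (D.s q) 1 by
    have := this (D.s q) 1
    rwa [D.map_s, mul_one] at this
  intro g
  induction g using HNNExtension.induction_on with
  | of h => exact D.cocycle_s_smul hker h
  | t => exact D.cocycle_s_t hker
  | mul g k hg hk => intro q; rw [map_mul, mul_assoc, hg, hk]
  | inv g hg => intro q; rw [← hg]; simp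

/-- A generator of a vertex group is `s(q)⁻¹ n s(q)` with `n ∈ N`; the middle factor contributes the
generator itself, and the outer ones contribute `c(s q, 1)` and its inverse, which are independent
of `q`. -/
theorem cocycle_L (hker : ∀ h : H, π (of h) = 1 ↔ h ∈ N) (p : D.P N) :
    D.cocycle hker (D.L N p) 1 =
      (D.cocycle hker (D.s 1) 1)⁻¹ * p * D.cocycle hker (D.s 1) 1 := by
  induction p using CoprodI.induction_on with
  | one => simp [cocycle_one]
  | of i m =>
    obtain ⟨q, rfl⟩ : ∃ q, i = D.vT q := by
      obtain ⟨_, q, rfl⟩ := i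
      exact ⟨q, rfl⟩
    obtain ⟨x, hx⟩ := m
    have hJ : CoprodI.of (i := D.vT q) ⟨x, hx⟩ = D.J N q x := by
      rw [J, dif_pos hx]
    obtain ⟨n, hn, hx'⟩ := D.mem_K_iff.1 hx
    have hL : D.L N (CoprodI.of (i := D.vT q) ⟨x, hx⟩) = x := by
      rw [hJ, D.L_J hx]
    have h1 := (hker n).2 hn
    have h2 := D.cocycle_inv hker (D.s q) 1
    rw [D.map_s, mul_one, D.cocycle_s] at h2
    change D.cocycle hker (D.L N (CoprodI.of (i := D.vT q) ⟨x, hx⟩)) 1 =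
      _ * (CoprodI.of (i := D.vT q) ⟨x, hx⟩) * _
    rw [hL, hJ, hx', cocycle_mul, cocycle_mul, D.map_s, mul_one, h1, one_mul, h2, D.cocycle_s hker q,
      cocycle_of, baseCocycle, h1, one_mul]
  | mul x y hx hy =>
    rw [map_mul, cocycle_mul, D.map_L hker, one_mul, hx, hy]
    simp [mul_assoc]

theorem L_injective (hker : ∀ h : H, π (of h) = 1 ↔ h ∈ N) : Function.Injective (D.L N) := by
  intro p p' h
  have := congrArg (fun x => D.cocycle hker x 1) h
  simpa [cocycle_L] using this

theorem range_L (hker : ∀ h : H, π (of h) = 1 ↔ h ∈ N) : (D.L N).range = π.ker := by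
  apply le_antisymm
  · rintro _ ⟨p, rfl⟩
    exact D.map_L hker p
  · intro g hg
    -- `s 1` need not be `1`, so `g` is conjugated in advance to offset the conjugation in
    -- `L_cocycle`.
    have hg' : π (D.s 1 * g * (D.s 1)⁻¹) = 1 := by
      rw [map_mul, map_mul, MonoidHom.mem_ker.1 hg]; simp
    refine ⟨D.cocycle hker (D.s 1 * g * (D.s 1)⁻¹) 1, ?_⟩
    rw [L_cocycle, hg']
    simp [mul_assoc]

end TreeLift

/-! ### Lifting the tree by normal forms -/

theorem Subgroup.exists_rightCoset_section {Q : Type*} [Group Q] (S : Subgroup Q) :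
    ∃ r : Q → Q, (∀ x ∈ S, ∀ q, r (x * q) = r q) ∧ ∀ q, ∃ x ∈ S, q = x * r q := by
  refine ⟨fun q => (Quotient.mk (QuotientGroup.rightRel S) q).out, fun x hx q => ?_, fun q => ?_⟩
  · refine congrArg Quotient.out (Quotient.sound ?_)
    change QuotientGroup.rightRel S _ _
    rw [QuotientGroup.rightRel_apply]
    simpa using hx
  · have h : QuotientGroup.rightRel S (Quotient.mk (QuotientGroup.rightRel S) q).out q :=
      Quotient.mk_out q
    rw [QuotientGroup.rightRel_apply] at h
    exact ⟨_, h, by simp⟩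

namespace HNNExtension

open NormalWord

variable {H : Type*} [Group H] {A B : Subgroup H} {φ : A ≃* B} {R : Type*}

section wordLift

variable (σ : R → H)

variable (φ) in
/-- The lift of a list of letters of a normal word. -/
def listLift (l : List (ℤˣ × R)) : HNNExtension H A B φ :=
  (l.map fun x => t ^ (x.1 : ℤ) * of (σ x.2)).prod

@[simp]
theorem listLift_cons (x : ℤˣ × R) (l : List (ℤˣ × R)) :
    listLift φ σ (x :: l) = t ^ (x.1 : ℤ) * of (σ x.2) * listLift φ σ l := by
  simp [listLift]

variable [Group R] {A' B' : Subgroup R} {φ' : A' ≃* B'} {d : TransversalPair R A' B'}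

variable (φ) in
/-- The lift of a normal word. -/
def wordLift (w : NormalWord d) : HNNExtension H A B φ :=
  of (σ w.head) * listLift φ σ w.toList

variable {σ} {π : HNNExtension H A B φ →* HNNExtension R A' B' φ'} {f : H →* R}

theorem map_listLift (hof : ∀ h, π (of h) = of (f h)) (ht : π t = t)
    (hσ : ∀ r, f (σ r) = r) (l : List (ℤˣ × R)) :
    π (listLift φ σ l) = (l.map fun x => t ^ (x.1 : ℤ) * of x.2).prod := by
  rw [listLift, map_list_prod, List.map_map]
  congr 2
  funext x
  simp [hof, ht, hσ]

theorem map_wordLift (hof : ∀ h, π (of h) = of (f h)) (ht : π t = t)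
    (hσ : ∀ r, f (σ r) = r) (w : NormalWord d) : π (wordLift φ σ w) = w.prod φ' := by
  rw [wordLift, map_mul, map_listLift hof ht hσ, hof, hσ]
  rfl

/-- Multiplying a normal word by `t` either cancels its first letter or adds one. In both cases the
part of the head lying in `A'` is lifted into `A` instead of by `σ`, so that `t` can be moved past
it in `G`. -/
theorem exists_edge_lift (hof : ∀ h, π (of h) = of (f h)) (ht : π t = t)
    (hσ : ∀ r, f (σ r) = r) (hA : ∀ a' : A', ∃ a : A, f a = a' ∧ f (φ a) = φ' a')
    (w : NormalWord d) :
    ∃ e, π e = w.prod φ' ∧ (∃ h, e = of h * wordLift φ σ w) ∧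
      ∃ h, t * e = of h * wordLift φ σ ((t : HNNExtension R A' B' φ') • w) := by
  rw [t_smul_eq_unitsSMul]
  by_cases hc : Cancels 1 w
  · cases w using consRecOn with
    | ofGroup g => simp [Cancels] at hc
    | cons g u w h1 h2 =>
      obtain ⟨hg, hu⟩ := hc
      obtain rfl : u = -1 := by simpa using hu
      obtain ⟨a, ha, ha'⟩ := hA ⟨g, hg⟩
      -- The word begins `g t⁻¹` with `g ∈ A'`; with `a` in place of `σ g`, the lift satisfies `t a
      -- t⁻¹ = φ a`.
      refine ⟨of (a : H) * listLift φ σ (cons g (-1) w h1 h2).toList, ?_, ⟨a * (σ g)⁻¹, ?_⟩, ?_⟩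
      · rw [map_mul, hof, map_listLift hof ht hσ, ha]; rfl
      · simp [wordLift, mul_assoc]
      · have hun : unitsSMul φ' 1 (cons g (-1) w h1 h2) = (φ' ⟨g, hg⟩ : R) • w := by
          rw [unitsSMul, dif_pos ⟨hg, by simp⟩]; rfl
        rw [hun]
        refine ⟨φ a * σ w.head * (σ ((φ' ⟨g, hg⟩ : R) * w.head))⁻¹, ?_⟩
        rw [← mul_assoc, t_mul_of]
        simp [wordLift, mul_assoc]
  · have hun : ∃ (a' : A') (c : R), w.head = a' * c ∧
        (unitsSMul φ' 1 w).head = φ' a' ∧ (unitsSMul φ' 1 w).toList = (1, c) :: w.toList := by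
      refine ⟨((d.compl 1).equiv w.head).1, ((d.compl 1).equiv w.head).2, ?_, ?_, ?_⟩
      · exact ((d.compl 1).equiv_fst_mul_equiv_snd _).symm
      · rw [unitsSMul, dif_neg hc]; rfl
      · rw [unitsSMul, dif_neg hc]; simp [unitsSMulGroup_snd]
    obtain ⟨a', c, h1, h2, h3⟩ := hun
    obtain ⟨a, ha, ha'⟩ := hA a'
    -- The head is `a' c` with `c` in the transversal. The new word keeps the letter `t c`, so `c`
    -- must be lifted by `σ`, while `a'` is lifted to `a`.
    refine ⟨of (a * σ c : H) * listLift φ σ w.toList, ?_, ⟨a * σ c * (σ w.head)⁻¹, ?_⟩,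
      ⟨φ a * (σ (φ' a'))⁻¹, ?_⟩⟩
    · rw [map_mul, hof, map_listLift hof ht hσ, map_mul, ha, hσ, ← h1]; rfl
    · simp [wordLift, mul_assoc]
    · rw [wordLift, h2, h3, listLift_cons, map_mul, ← mul_assoc, ← mul_assoc, t_mul_of]
      simp [mul_assoc]

end wordLift

/-- The Bass-Serre tree of an HNN extension of a quotient of the base group lifts to the
HNN extension of the base group. -/
theorem nonempty_treeLift [Group R] {A' B' : Subgroup R} {φ' : A' ≃* B'}
    {π : HNNExtension H A B φ →* HNNExtension R A' B' φ'} {f : H →* R}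
    (hof : ∀ h, π (of h) = of (f h)) (ht : π t = t) (hf : Function.Surjective f)
    (hA : ∀ a' : A', ∃ a : A, f a = a' ∧ f (φ a) = φ' a')
    (hinj : ∀ a : A, f a = 1 → a = 1) :
    Nonempty (TreeLift π) := by
  obtain ⟨d⟩ := TransversalPair.nonempty R A' B'
  obtain ⟨σ, hσ⟩ := hf.hasRightInverse
  let s (q : HNNExtension R A' B' φ') : HNNExtension H A B φ :=
    wordLift φ σ (q • (NormalWord.empty : NormalWord d))
  have hs (q) : π (s q) = q := by
    rw [map_wordLift hof ht hσ, prod_smul, prod_empty, mul_one]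
  have hsH (h : H) (q) : ∃ h', s (π (of h) * q) = of h' * s q := by
    refine ⟨σ (f h * (q • (NormalWord.empty : NormalWord d)).head) *
      (σ (q • (NormalWord.empty : NormalWord d)).head)⁻¹, ?_⟩
    change wordLift φ σ _ = _ * wordLift φ σ _
    rw [mul_smul, hof, of_smul_eq_smul, wordLift, wordLift]
    simp [mul_assoc]
  have he (q) : ∃ e, π e = q ∧ (∃ h, e = of h * s q) ∧ ∃ h, t * e = of h * s (π t * q) := by
    have := exists_edge_lift hof ht hσ hA (q • (NormalWord.empty : NormalWord d))
    rwa [prod_smul, prod_empty, mul_one, ← mul_smul, ← ht] at this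
  -- These edge lifts need not be equivariant. They are kept only at the representatives `r q` of
  -- the `A`-cosets and translated by the element `α q` of `A`.
  choose e₀ he₀ he₀s he₀t using he
  obtain ⟨r, hr, hr'⟩ := Subgroup.exists_rightCoset_section
    ((π.comp of).comp A.subtype).range
  replace hr (a : A) (q) : r (π (of (a : H)) * q) = r q := hr _ ⟨a, rfl⟩ q
  have hr'' (q) : ∃ a : A, q = π (of (a : H)) * r q := by
    obtain ⟨_, ⟨a, rfl⟩, hx⟩ := hr' q
    exact ⟨a, hx⟩
  choose α hα using hr''
  -- `A` acts freely on the quotient, since it embeds in `R` and `R` embeds in its HNN extension;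
  -- hence `α q` is unique.
  have hα_smul (a : A) (q) : α (π (of (a : H)) * q) = a * α q := by
    have h1 := hα (π (of (a : H)) * q)
    rw [hr] at h1
    generalize α (π (of (a : H)) * q) = β at h1 ⊢
    nth_rw 1 [hα q] at h1
    rw [← mul_assoc, mul_left_inj, hof, hof, hof, ← map_mul] at h1
    have h2 := of_injective φ' h1
    have h3 := hinj ((a * α q)⁻¹ * β) (by
      simp only [Subgroup.coe_mul, Subgroup.coe_inv, map_mul, map_inv]
      rw [← h2]; simp)
    rw [inv_mul_eq_one] at h3
    exact h3.symm
  obtain ⟨ρ, hρ, hρ'⟩ := Subgroup.exists_rightCoset_section (π.comp (of : H →* _)).range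
  replace hρ (h : H) (q) : ρ (π (of h) * q) = ρ q := hρ _ ⟨h, rfl⟩ q
  have hsρ (q) : ∃ h, s q = of h * s (ρ q) := by
    obtain ⟨_, ⟨h, rfl⟩, hx⟩ := hρ' q
    obtain ⟨h', hh⟩ := hsH h (ρ q)
    exact ⟨h', by rw [← hh]; exact congrArg s hx⟩
  refine ⟨{ s := s, e := fun q => of (α q : H) * e₀ (r q), v := fun q => (s (ρ q))⁻¹,
            map_s := hs, map_e := ?_, e_eq := ?_, t_mul_e := ?_, e_smul := ?_, v_smul := ?_,
            s_eq := ?_ }⟩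
  · intro q
    rw [map_mul, he₀, ← hα]
  · intro q
    obtain ⟨h, hh⟩ := he₀s (r q)
    obtain ⟨h', hh'⟩ := hsH (α q) (r q)
    rw [← hα] at hh'
    exact ⟨α q * h * h'⁻¹, by rw [hh, hh']; simp [mul_assoc]⟩
  · intro q
    obtain ⟨h, hh⟩ := he₀t (r q)
    obtain ⟨h', hh'⟩ := hsH (φ (α q)) (π t * r q)
    rw [← mul_assoc, ← map_mul, ← t_mul_of, map_mul, mul_assoc, ← hα] at hh'
    refine ⟨φ (α q) * h * h'⁻¹, ?_⟩
    rw [← mul_assoc, t_mul_of, mul_assoc, hh, hh']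
    simp [mul_assoc]
  · intro a q
    simp only [hα_smul, hr]
    simp [mul_assoc]
  · intro h q
    simp only [hρ]
  · intro q
    simpa using hsρ q

end HNNExtension

/-! ### Induced representations -/

/-- In the coinvariant model `IndV.mk φ ρ h a` plays the role of `h⁻¹ ⊗ a`. This is the rule for
moving a scalar across the tensor sign, and the source of the inverses below. -/
theorem Representation.IndV.mk_mul_apply {k G H A : Type*} [CommRing k] [Group G] [Group H]
    (φ : G →* H) [AddCommGroup A] [Module k A] (ρ : Representation k G A) (g : G) (h : H) (a : A) :
    IndV.mk φ ρ (φ g * h) (ρ g a) = IndV.mk φ ρ h a := by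
  have := Coinvariants.mk_self_apply (Representation.tprod ((leftRegular k H).comp φ) ρ) g
    (TensorProduct.tmul k (MonoidAlgebra.single h 1) a)
  simpa using this

theorem Representation.IndV.induction_on {k G H A : Type*} [CommRing k] [Group G] [Group H]
    {φ : G →* H} [AddCommGroup A] [Module k A] {ρ : Representation k G A}
    {motive : IndV φ ρ → Prop} (x : IndV φ ρ) (zero : motive 0)
    (mk : ∀ h a, motive (IndV.mk φ ρ h a)) (add : ∀ x y, motive x → motive y → motive (x + y)) :
    motive x := by
  induction x using Coinvariants.induction_on with | _ v
  induction v using TensorProduct.induction_on with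
  | zero => rw [map_zero]; exact zero
  | add x y hx hy => rw [map_add]; exact add _ _ hx hy
  | tmul x a =>
    induction x using MonoidAlgebra.induction_linear with
    | zero => rw [TensorProduct.zero_tmul, map_zero]; exact zero
    | add x y hx hy => rw [TensorProduct.add_tmul, map_add]; exact add _ _ hx hy
    | single h c =>
      have : MonoidAlgebra.single h c = c • MonoidAlgebra.single h (1 : k) := by simp
      rw [this, TensorProduct.smul_tmul]
      exact mk h (c • a)

/-- The map out of an induced representation given by Frobenius reciprocity. -/
noncomputable def Representation.indLift {k G H A B : Type*} [CommRing k] [Group G] [Group H]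
    {φ : G →* H} [AddCommGroup A] [Module k A] {ρ : Representation k G A}
    [AddCommGroup B] [Module k B] {τ : Representation k H B} (f : A →ₗ[k] B)
    (hf : ∀ g a, f (ρ g a) = τ (φ g) (f a)) : IntertwiningMap (ind φ ρ) τ where
  toLinearMap := Coinvariants.lift _
    (TensorProduct.lift <| (Finsupp.lift _ _ _ fun h => τ h⁻¹ ∘ₗ f) ∘ₗ
      (MonoidAlgebra.coeffLinearEquiv k).toLinearMap)
    fun g => by
      ext h x
      simp [hf, ← Module.End.mul_apply, ← map_mul]
  isIntertwining' := fun g => by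
    ext h x
    simp

theorem Representation.indLift_mk {k G H A B : Type*} [CommRing k] [Group G] [Group H]
    {φ : G →* H} [AddCommGroup A] [Module k A] {ρ : Representation k G A}
    [AddCommGroup B] [Module k B] {τ : Representation k H B} (f : A →ₗ[k] B)
    (hf : ∀ g a, f (ρ g a) = τ (φ g) (f a)) (h : H) (a : A) :
    indLift f hf (IndV.mk φ ρ h a) = τ h⁻¹ (f a) := by
  change TensorProduct.lift ((Finsupp.lift _ _ _ fun h => τ h⁻¹ ∘ₗ f) ∘ₗ
    (MonoidAlgebra.coeffLinearEquiv k).toLinearMap)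
    (TensorProduct.tmul k (MonoidAlgebra.single h (1 : k)) a) = _
  simp

/-! ### Relation modules of Cohen-Lyndon triples -/

section

variable {G H : Type*} [Group G] [Group H] (f : H →* G) (N : Subgroup H)

/-- The homomorphism from a subgroup to the normal closure of its image. -/
def toNormalClosureMap : N →* Subgroup.normalClosure ((N.map f : Subgroup G) : Set G) :=
  (f.comp N.subtype).codRestrict _ fun n =>
    Subgroup.subset_normalClosure (Subgroup.mem_map_of_mem f n.2)

variable [N.Normal]

/-- The map induced on relation modules. -/
noncomputable def relRelationMap : Additive (Abelianization N) →ₗ[ℤ]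
    Additive (Abelianization (Subgroup.normalClosure ((N.map f : Subgroup G) : Set G))) :=
  (MonoidHom.toAdditive (Abelianization.map (toNormalClosureMap f N))).toIntLinearMap

theorem relRelationMap_smul (g : H ⧸ N) (a : Additive (Abelianization N)) :
    relRelationMap f N (relRelationRep N g a) =
      relRelationRep _ (quotientNormalClosureMap f N g) (relRelationMap f N a) := by
  induction g using QuotientGroup.induction_on with | _ h
  induction a using Additive.rec with | _ a
  induction a using QuotientGroup.induction_on with | _ n
  change Additive.ofMul (Abelianization.of (toNormalClosureMap f N (MulAut.conjNormal h n))) =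
    Additive.ofMul (Abelianization.of (MulAut.conjNormal (f h) (toNormalClosureMap f N n)))
  refine congrArg _ (congrArg _ (Subtype.ext ?_))
  change f (h * n * h⁻¹) = f h * f n * (f h)⁻¹
  simp

/-- The map from the induced module to the relation module. -/
noncomputable def indRelRelationMap : Representation.IntertwiningMap
    (Representation.ind (quotientNormalClosureMap f N) (relRelationRep N))
    (relRelationRep (Subgroup.normalClosure ((N.map f : Subgroup G) : Set G))) :=
  Representation.indLift (relRelationMap f N) (relRelationMap_smul f N)

theorem indRelRelationMap_mk (g : G) (n : N) :
    indRelRelationMap f N (Representation.IndV.mk _ _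
      ((g : G ⧸ Subgroup.normalClosure ((N.map f : Subgroup G) : Set G))⁻¹)
      (Additive.ofMul (Abelianization.of n))) =
    Additive.ofMul (Abelianization.of (MulAut.conjNormal g (toNormalClosureMap f N n))) := by
  rw [indRelRelationMap, Representation.indLift_mk, inv_inv]
  rfl

variable {f N}

/-- The homomorphism `t f(n) t⁻¹ ↦ t ⊗ n` from a conjugate of the image of `N` to the induced
module. -/
noncomputable def conjInd (hf : Function.Injective f) (t : G) :
    (N.map f).map (MulAut.conj t).toMonoidHom →* Multiplicative
      (Representation.IndV (quotientNormalClosureMap f N) (relRelationRep N)) :=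
  ((AddMonoidHom.toMultiplicativeLeft (Representation.IndV.mk (quotientNormalClosureMap f N)
    (relRelationRep N)
      ((t : G ⧸ Subgroup.normalClosure ((N.map f : Subgroup G) : Set G))⁻¹)).toAddMonoidHom).comp
      Abelianization.of).comp
    ((N.equivMapOfInjective f hf).trans
      ((N.map f).equivMapOfInjective _ (MulAut.conj t).injective)).symm.toMonoidHom

theorem conjInd_apply (hf : Function.Injective f) (t : G) (n : N)
    (h : t * f n * t⁻¹ ∈ (N.map f).map (MulAut.conj t).toMonoidHom) :
    conjInd hf t ⟨t * f n * t⁻¹, h⟩ = Multiplicative.ofAdd (Representation.IndV.mk _ _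
      ((t : G ⧸ Subgroup.normalClosure ((N.map f : Subgroup G) : Set G))⁻¹)
      (Additive.ofMul (Abelianization.of n))) := by
  have : (⟨t * f n * t⁻¹, h⟩ : (N.map f).map (MulAut.conj t).toMonoidHom) =
    ((N.equivMapOfInjective f hf).trans
      ((N.map f).equivMapOfInjective _ (MulAut.conj t).injective)) n := rfl
  rw [this, conjInd, MonoidHom.comp_apply]
  erw [MulEquiv.symm_apply_apply]
  rfl

/-- For a Cohen-Lyndon triple the relation module is induced. -/
theorem CohenLyndonProperty.bijective_indRelRelationMap (hf : Function.Injective f)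
    (hCL : CohenLyndonProperty f.range (N.map f)) :
    Function.Bijective (indRelRelationMap f N) := by
  obtain ⟨T, hT, hinj, hrange⟩ := hCL
  set L := CoprodI.lift fun t : T =>
    ((N.map f).map (MulAut.conj (t : G)).toMonoidHom).subtype with hL
  let F := CoprodI.lift fun t : T => conjInd (N := N) hf (t : G)
  have hmem (p) : L p ∈ Subgroup.normalClosure ((N.map f : Subgroup G) : Set G) :=
    hrange ▸ ⟨p, rfl⟩
  -- The inverse is defined on the free product by its values on the factors, then carried to `⟪N⟫`
  -- along the isomorphism `L`.
  obtain ⟨Ψ, hΨ⟩ : ∃ Ψ : Subgroup.normalClosure ((N.map f : Subgroup G) : Set G) →*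
      Multiplicative (Representation.IndV (quotientNormalClosureMap f N) (relRelationRep N)),
      ∀ p, Ψ ⟨L p, hmem p⟩ = F p := by
    refine ⟨F.comp ((MonoidHom.ofInjective hinj).trans
      (MulEquiv.subgroupCongr hrange)).symm.toMonoidHom, fun p => ?_⟩
    rw [MonoidHom.comp_apply]
    refine congrArg F ((MulEquiv.symm_apply_eq _).2 ?_)
    rfl
  have hconj (t : T) (n : N) : ∃ p, L p = t * f n * (t : G)⁻¹ ∧ F p = Multiplicative.ofAdd
      (Representation.IndV.mk _ _
      (((t : G) : G ⧸ Subgroup.normalClosure ((N.map f : Subgroup G) : Set G))⁻¹)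
      (Additive.ofMul (Abelianization.of n))) := by
    have h : (t : G) * f n * (t : G)⁻¹ ∈ (N.map f).map (MulAut.conj (t : G)).toMonoidHom :=
      ⟨f n, ⟨n, n.2, rfl⟩, rfl⟩
    refine ⟨CoprodI.of (i := t) ⟨_, h⟩, ?_, ?_⟩
    · rw [hL, CoprodI.lift_of]; rfl
    · change CoprodI.lift _ _ = _
      rw [CoprodI.lift_of, conjInd_apply]
  let Ψ' : Additive (Abelianization (Subgroup.normalClosure ((N.map f : Subgroup G) : Set G))) →+
      Representation.IndV (quotientNormalClosureMap f N) (relRelationRep N) :=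
    MonoidHom.toAdditiveLeft (Abelianization.lift Ψ)
  have hΨ' (x) : Ψ' (Additive.ofMul (Abelianization.of x)) = (Ψ x).toAdd := rfl
  have hΨconj (t : T) (n : N) : Ψ' (Additive.ofMul (Abelianization.of
      (MulAut.conjNormal (t : G) (toNormalClosureMap f N n)))) = Representation.IndV.mk _ _
      (((t : G) : G ⧸ Subgroup.normalClosure ((N.map f : Subgroup G) : Set G))⁻¹)
      (Additive.ofMul (Abelianization.of n)) := by
    obtain ⟨p, hp, hp'⟩ := hconj t n
    have : MulAut.conjNormal (t : G) (toNormalClosureMap f N n) = ⟨L p, hmem p⟩ :=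
      Subtype.ext hp.symm
    rw [this, hΨ', hΨ, hp']
    rfl
  refine Function.bijective_iff_has_inverse.2 ⟨Ψ', fun x => ?_, fun x => ?_⟩
  · induction x using Representation.IndV.induction_on with
    | zero => rw [map_zero, map_zero]
    | add x y hx hy => rw [map_add, map_add, hx, hy]
    | mk q a =>
      obtain ⟨g, hg⟩ := QuotientGroup.mk_surjective q⁻¹
      -- The transversal gives `g = t f(h) k` with `k ∈ ⟪N⟫`. Modulo `⟪N⟫` the factor `f(h)` is
      -- absorbed into the coefficient, which leaves a generator `t ⊗ b`.
      obtain ⟨⟨t, x⟩, htx⟩ := hT.2 g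
      obtain ⟨_, ⟨h, rfl⟩, k, hk, hhk⟩ := Subgroup.mem_sup_of_normal_right.1 x.2
      have hq : q⁻¹ = (t : G) * quotientNormalClosureMap f N h := by
        rw [← hg, ← htx]
        change (QuotientGroup.mk ((t : G) * (x : G)) :
          G ⧸ Subgroup.normalClosure ((N.map f : Subgroup G) : Set G)) =
          QuotientGroup.mk ((t : G) * f h)
        rw [QuotientGroup.eq, ← hhk]
        simpa using inv_mem hk
      obtain rfl : q = quotientNormalClosureMap f N (h : H ⧸ N)⁻¹ * ((t : G) : G ⧸ _)⁻¹ := by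
        rw [← inv_inv q, hq, mul_inv_rev, map_inv]
      obtain ⟨b, rfl⟩ : ∃ b, a = relRelationRep N (h : H ⧸ N)⁻¹ b :=
        ⟨relRelationRep N h a, by rw [← Module.End.mul_apply, ← map_mul]; simp⟩
      rw [Representation.IndV.mk_mul_apply]
      induction b using Additive.rec with | _ b
      induction b using QuotientGroup.induction_on with | _ n
      change Ψ' (indRelRelationMap f N (Representation.IndV.mk _ _ _
        (Additive.ofMul (Abelianization.of n)))) = _
      rw [indRelRelationMap_mk, hΨconj]
      rfl
  · induction x using Additive.rec with | _ x
    induction x using QuotientGroup.induction_on with | _ x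
    obtain ⟨x, hx⟩ := x
    obtain ⟨p, rfl⟩ : ∃ p, L p = x := by rwa [← hrange] at hx
    change indRelRelationMap f N (Ψ' (Additive.ofMul (Abelianization.of ⟨L p, hx⟩))) =
      Additive.ofMul (Abelianization.of ⟨L p, hx⟩)
    induction p using CoprodI.induction_on with
    | one =>
      have : (⟨L 1, hx⟩ : Subgroup.normalClosure ((N.map f : Subgroup G) : Set G)) = 1 :=
        Subtype.ext (map_one L)
      rw [this, map_one, ofMul_one, map_zero, map_zero]
    | of t m =>
      obtain ⟨_, _, ⟨n, hn, rfl⟩, rfl⟩ := m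
      have : (⟨L (CoprodI.of (i := t) ⟨(MulAut.conj (t : G)).toMonoidHom (f n),
            ⟨f n, ⟨n, hn, rfl⟩, rfl⟩⟩), hx⟩ :
          Subgroup.normalClosure ((N.map f : Subgroup G) : Set G)) =
          MulAut.conjNormal (t : G) (toNormalClosureMap f N ⟨n, hn⟩) := by
        refine Subtype.ext ?_
        change L _ = _
        rw [hL, CoprodI.lift_of]
        rfl
      rw [this, hΨconj, indRelRelationMap_mk]
    | mul p p' hp hp' =>
      have : (⟨L (p * p'), hx⟩ : Subgroup.normalClosure ((N.map f : Subgroup G) : Set G)) =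
          ⟨L p, hmem p⟩ * ⟨L p', hmem p'⟩ := Subtype.ext (map_mul L p p')
      rw [this, map_mul, ofMul_mul, map_add, map_add, hp, hp']

/-- For a Cohen-Lyndon triple the relation module is isomorphic to the induced module. -/
theorem CohenLyndonProperty.nonempty_linearEquiv_ind (hf : Function.Injective f)
    (hCL : CohenLyndonProperty f.range (N.map f)) :
    Nonempty ((relRelationRep (Subgroup.normalClosure
        ((N.map f : Subgroup G) : Set G))).asModule ≃ₗ[MonoidAlgebra ℤ (G ⧸
          Subgroup.normalClosure ((N.map f : Subgroup G) : Set G))]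
      (Representation.ind (quotientNormalClosureMap f N) (relRelationRep N)).asModule) :=
  ⟨(LinearEquiv.ofBijective
    (Representation.IntertwiningMap.equivLinearMapAsModule _ _ (indRelRelationMap f N))
    (hCL.bijective_indRelRelationMap hf)).symm⟩

end

/-! ### The Cohen-Lyndon property from a lifted tree -/

namespace TreeLift

open HNNExtension

variable {H : Type*} [Group H] {A B : Subgroup H} {φ : A ≃* B} {Q : Type*} [Group Q]
  {π : HNNExtension H A B φ →* Q} {N : Subgroup H} [N.Normal]

/-- The kernel is the range of `L`, hence generated by conjugates of `N`; conversely it is normal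
and contains `N`. -/
theorem ker_eq_normalClosure (D : TreeLift π) (hker : ∀ h : H, π (of h) = 1 ↔ h ∈ N) :
    π.ker = Subgroup.normalClosure
      ((N.map of : Subgroup (HNNExtension H A B φ)) : Set (HNNExtension H A B φ)) := by
  apply le_antisymm
  · rw [← D.range_L hker]
    refine CoprodI.lift_range_le _ _ fun i => ?_
    rintro _ ⟨⟨_, _, ⟨n, hn, rfl⟩, rfl⟩, rfl⟩
    exact Subgroup.normalClosure_normal.conj_mem _
      (Subgroup.subset_normalClosure (Subgroup.mem_map_of_mem of hn)) _
  · refine Subgroup.normalClosure_le_normal ?_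
    rintro _ ⟨n, hn, rfl⟩
    exact (hker n).2 hn

theorem map_v (D : TreeLift π) (q : Q) : ∃ h : H, π (D.v q) = q⁻¹ * π (of h) := by
  obtain ⟨h, hh⟩ := D.s_eq q
  refine ⟨h, ?_⟩
  have := congrArg π hh
  rw [map_mul, map_inv, D.map_s] at this
  exact eq_inv_mul_iff_mul_eq.2 (eq_mul_inv_iff_mul_eq.1 this)

/-- By `map_v`, `π (v q)` lies in the left coset `q⁻¹ π(H)`, and `v` depends only on the right coset
`π(H) q`. Inversion matches right cosets with left ones, so `v` hits each left coset of `H ker π`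
exactly once. -/
theorem isComplement_T (D : TreeLift π) :
    Subgroup.IsComplement D.T ((of.range ⊔ π.ker : Subgroup _) : Set (HNNExtension H A B φ)) := by
  constructor
  · rintro ⟨⟨_, q, rfl⟩, x, hx⟩ ⟨⟨_, q', rfl⟩, x', hx'⟩ h
    change D.v q * x = D.v q' * x' at h
    have hmem : (D.v q)⁻¹ * D.v q' ∈ of.range ⊔ π.ker := by
      rw [← eq_inv_mul_iff_mul_eq] at h
      have : (D.v q)⁻¹ * D.v q' = x * x'⁻¹ := by rw [h]; simp [← mul_assoc]
      rw [this]
      exact mul_mem hx (inv_mem hx')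
    obtain ⟨_, ⟨k, rfl⟩, y, hy, hk⟩ := Subgroup.mem_sup_of_normal_right.1 hmem
    obtain ⟨h₁, hh₁⟩ := D.map_v q
    obtain ⟨h₂, hh₂⟩ := D.map_v q'
    have hq : q = π (of (h₁ * k * h₂⁻¹)) * q' := by
      have := congrArg π hk
      rw [map_mul, MonoidHom.mem_ker.1 hy, mul_one, map_mul, map_inv, hh₁, hh₂] at this
      simp only [map_mul, map_inv, this]
      simp [mul_assoc]
    have hv : D.v q = D.v q' := by rw [hq, D.v_smul]
    rw [hv, mul_right_inj] at h
    subst h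
    simp [hv]
  · intro g
    obtain ⟨h, hh⟩ := D.map_v (π g)⁻¹
    have hmem : (D.v (π g)⁻¹)⁻¹ * g ∈ of.range ⊔ π.ker := by
      have : (D.v (π g)⁻¹)⁻¹ * g = of h⁻¹ * (of h * (D.v (π g)⁻¹)⁻¹ * g) := by
        simp [mul_assoc]
      rw [this]
      refine Subgroup.mul_mem_sup ⟨_, rfl⟩ ?_
      rw [MonoidHom.mem_ker, map_mul, map_mul, map_inv, hh]
      simp
    exact ⟨(⟨_, _, rfl⟩, ⟨_, hmem⟩), mul_inv_cancel_left _ _⟩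

theorem cohenLyndonProperty (D : TreeLift π)
    (hker : ∀ h : H, π (of h) = 1 ↔ h ∈ N) :
    CohenLyndonProperty (of : H →* HNNExtension H A B φ).range (N.map of) := by
  refine ⟨D.T, ?_, D.L_injective hker, ?_⟩
  · rw [← D.ker_eq_normalClosure hker]
    exact D.isComplement_T
  · rw [← D.ker_eq_normalClosure hker]
    exact D.range_L hker

end TreeLift

/-! ### The quotient HNN extension and the theorem -/

theorem injective_mk_of_inf_eq_bot {H : Type*} [Group H] {N S : Subgroup H} [N.Normal]
    (h : ∀ x ∈ N, x ∈ S → x = 1) :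
    Function.Injective ((QuotientGroup.mk' N).comp S.subtype) := by
  refine (injective_iff_map_eq_one _).2 fun x hx => Subtype.ext (h x ?_ x.2)
  exact (QuotientGroup.eq_one_iff _).1 hx

-- The projection to `H/N` is injective on `A` and on `B`, so `φ` transports to an isomorphism of
-- their images. The base group embeds in the resulting HNN extension, so an element of `H` dies
-- there only if it lies in `N`.
open HNNExtension in
theorem HNNExtension.exists_quotient_treeLift {H : Type*} [Group H] {A B : Subgroup H}
    (φ : A ≃* B) {N : Subgroup H} [N.Normal] (hA : ∀ x ∈ N, x ∈ A → x = 1)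
    (hB : ∀ x ∈ N, x ∈ B → x = 1) :
    ∃ (A' B' : Subgroup (H ⧸ N)) (φ' : A' ≃* B')
      (π : HNNExtension H A B φ →* HNNExtension (H ⧸ N) A' B' φ'),
      Nonempty (TreeLift π) ∧ ∀ h : H, π (of h) = 1 ↔ h ∈ N := by
  have hA' := injective_mk_of_inf_eq_bot hA
  have hB' := injective_mk_of_inf_eq_bot hB
  let φ' := (MonoidHom.ofInjective hA').symm.trans (φ.trans (MonoidHom.ofInjective hB'))
  have hφ (a : A) : φ' (MonoidHom.ofInjective hA' a) = MonoidHom.ofInjective hB' (φ a) := by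
    simp [φ']
  let π : HNNExtension H A B φ →* HNNExtension (H ⧸ N) _ _ φ' :=
    lift (of.comp (QuotientGroup.mk' N)) t fun a => by
      have := t_mul_of (φ := φ') (MonoidHom.ofInjective hA' a)
      rw [hφ] at this
      exact this
  have hof (h : H) : π (of h) = of (QuotientGroup.mk' N h) := lift_of _ _ _ h
  refine ⟨_, _, φ', π, nonempty_treeLift hof (lift_t _ _ _) (QuotientGroup.mk'_surjective N)
    (fun a' => ?_) (fun a ha => (injective_iff_map_eq_one _).1 hA' a ha), fun h => ?_⟩
  · obtain ⟨a, rfl⟩ := (MonoidHom.ofInjective hA').surjective a'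
    exact ⟨a, rfl, by rw [hφ]; rfl⟩
  · rw [hof, map_eq_one_iff _ (of_injective φ')]
    exact QuotientGroup.eq_one_iff h

/-- `HNNExtension H A B φ` is the HNN extension `G` of `H` with associated subgroups `A` and `B`,
and `HNNExtension.of` is the canonical embedding of `H` into it. The last clause is the
isomorphism of `ℤQ`-modules between `Rel(G, ⟪N⟫)` and the module induced from `Rel(H, N)` along
the natural injection `R = H/N → Q = G/⟪N⟫`. -/
theorem mainTheorem7 {H : Type*} [Group H] (A B : Subgroup H) (φ : A ≃* B)
    (N : Subgroup H) [N.Normal]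
    (hN : (N : Set H) ∩ ((A : Set H) ∪ (B : Set H)) = {1}) :
    CohenLyndonProperty (HNNExtension.of : H →* HNNExtension H A B φ).range
        (N.map (HNNExtension.of : H →* HNNExtension H A B φ)) ∧
      Function.Injective
        (quotientNormalClosureMap (HNNExtension.of : H →* HNNExtension H A B φ) N) ∧
      Nonempty
        ((relRelationRep (Subgroup.normalClosure
            ((N.map (HNNExtension.of : H →* HNNExtension H A B φ) :
              Subgroup (HNNExtension H A B φ)) : Set (HNNExtension H A B φ)))).asModule
          ≃ₗ[MonoidAlgebra ℤ (HNNExtension H A B φ ⧸ Subgroup.normalClosure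
            ((N.map (HNNExtension.of : H →* HNNExtension H A B φ) :
              Subgroup (HNNExtension H A B φ)) : Set (HNNExtension H A B φ)))]
        (Representation.ind
          (quotientNormalClosureMap (HNNExtension.of : H →* HNNExtension H A B φ) N)
          (relRelationRep N)).asModule) := by
  have hA : ∀ x ∈ N, x ∈ A → x = 1 := fun x hx hxA => hN.subset ⟨hx, Or.inl hxA⟩
  have hB : ∀ x ∈ N, x ∈ B → x = 1 := fun x hx hxB => hN.subset ⟨hx, Or.inr hxB⟩
  obtain ⟨A', B', φ', π, ⟨D⟩, hker⟩ := HNNExtension.exists_quotient_treeLift φ hA hB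
  have hCL := D.cohenLyndonProperty hker
  refine ⟨hCL, (injective_iff_map_eq_one _).2 fun x hx => ?_,
    hCL.nonempty_linearEquiv_ind (HNNExtension.of_injective φ)⟩
  -- An element of `H` that dies modulo `⟪N⟫ = ker π` lies in `N` by `hker`.
  induction x using QuotientGroup.induction_on with | _ h
  refine (QuotientGroup.eq_one_iff h).2 ((hker h).1 ?_)
  rw [← MonoidHom.mem_ker, D.ker_eq_normalClosure hker]
  exact (QuotientGroup.eq_one_iff _).1 hx
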